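/- Let $\mathcal H$ be a finite-dimensional complex Hilbert space, and let $\Lambda_t:\mathcal L(\mathcal H)\to\mathcal L(\mathcal H)$, $t\ge 0$, be a uniformly (norm-) continuous semigroup of unital completely positive linear maps: $\Lambda_0=\mathrm{Id}$ and $\Lambda_{s+t}=\Lambda_t\circ\Lambda_s$. Assume that there is a faithful invariant state $\sigma$, that is, a positive operator with $\mathrm{tr}[\sigma]=1$, $\ker\sigma=\{0\}$ and $\mathrm{tr}[\sigma\Lambda_t(A)]=\mathrm{tr}[\sigma A]$ for all $t\ge 0$ and $A\in\mathcal L(\mathcal H)$. Assume that the decoherence-free subalgebra $$\mathcal C=\{A\in\mathcal L(\mathcal H)\mid \Lambda_t(A^*A)=\Lambda_t(A)^*\Lambda_t(A),\ \Lambda_t(AA^*)=\Lambda_t(A)\Lambda_t(A)^*\ \text{for all } t\ge 0\}$$ is Abelian, and let $(P_k)_{k\in I}$, $I$ finite, be a resolution of the identity (mutually orthogonal projections with $\sum_k P_k=\mathbf 1$) consisting of minimal projections of $\mathcal C$. Then for each $k\in I$ the restriction of $\Lambda_t$ to $P_k\mathcal L(\mathcal H)P_k$ has a unique faithful invariant state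 $\sigma_k$, regarded as an operator on $\mathcal H$ with $\sigma_k=P_k\sigma_kP_k$. Let $\Gamma:\mathcal L(\mathcal H)\to\mathcal C$ be the conditional expectation $$\Gamma(A)=\sum_{k\in I}\mathrm{tr}[\sigma_kP_kAP_k]\,P_k ,$$ and suppose that there are constants $K,\gamma>0$ such that, in the operator norm of linear maps on $\mathcal L(\mathcal H)$, $$\|\Lambda_t-\Gamma\circ\Lambda_t\|\le K e^{-\gamma t}\qquad\text{for all } t\ge 0.$$ Let $\mathsf E=(\mathsf E(i))_{i\in\Omega_{\mathsf E}}$ and $\mathsf F=(\mathsf F(j))_{j\in\Omega_{\mathsf F}}$ be finite-outcome observables (finite families of positive operators summing to $\mathbf 1$) which are regular relative to $\mathcal C$: $P_k\mathsf E(i)P_k\ne 0$ and $P_k\mathsf F(j)P_k\neq 0$ for all $i,j,k$. Put $\lambda_{\mathsf E}=\min_{i,k}\mathrm{tr}[\sigma_kP_k\mathsf E(i)P_k]$ and $\lambda_{\mathsf F}=\min_{j,k}\mathrm{tr}[\sigma_kP_k\mathsf F(j)P_k]$. Then for every $t\ge 0$ with $$t\ \ge\ -\frac1\gamma\ln\frac{\lambda_{\mathsf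 E}\lambda_{\mathsf F}}{2K}$$ the observables $\Lambda_t(\mathsf E)=(\Lambda_t(\mathsf E(i)))_i$ and $\Lambda_t(\mathsf F)=(\Lambda_t(\mathsf F(j)))_j$ are jointly measurable, i.e. there is an observable $\mathsf G$ on $\Omega_{\mathsf E}\times\Omega_{\mathsf F}$ with $\sum_j\mathsf G(i,j)=\Lambda_t(\mathsf E(i))$ for all $i$ and $\sum_i\mathsf G(i,j)=\Lambda_t(\mathsf F(j))$ for all $j$. -/

import Mathlib

open scoped NNReal

namespace OpenQuantum

noncomputable section

variable {H : Type*} [NormedAddCommGroup H] [InnerProductSpace ℂ H] [CompleteSpace H]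

/-- The trace of an operator on a finite-dimensional Hilbert space. -/
def tr (A : H →L[ℂ] H) : ℂ := LinearMap.trace ℂ H (A : H →ₗ[ℂ] H)

/-- Complete positivity of a linear map on `L(H)`: all matrix amplifications preserve positivity. -/
def IsCompletelyPositive (Φ : (H →L[ℂ] H) →L[ℂ] (H →L[ℂ] H)) : Prop :=
  ∀ (k : ℕ) (M : CStarMatrix (Fin k) (Fin k) (H →L[ℂ] H)), 0 ≤ M → 0 ≤ M.map Φ

/-- A quantum channel in the Heisenberg picture: a completely positive unital linear map
(normality is automatic in finite dimension). -/
structure IsHeisenbergChannel (Φ : (H →L[ℂ] H) →L[ℂ] (H →L[ℂ] H)) : Prop where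
  completelyPositive : IsCompletelyPositive Φ
  unital : Φ 1 = 1

/-- A uniformly (that is, operator-norm) continuous one-parameter semigroup of Heisenberg
channels. -/
structure IsUniformlyContinuousSemigroup
    (Λ : ℝ≥0 → ((H →L[ℂ] H) →L[ℂ] (H →L[ℂ] H))) : Prop where
  channel : ∀ t, IsHeisenbergChannel (Λ t)
  zero : Λ 0 = ContinuousLinearMap.id ℂ (H →L[ℂ] H)
  add : ∀ s t, Λ (s + t) = (Λ t).comp (Λ s)
  continuous : Continuous Λ

/-- A state: a positive operator of trace one. -/
def IsState (ρ : H →L[ℂ] H) : Prop := 0 ≤ ρ ∧ tr ρ = 1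

/-- A faithful state that is invariant under the predual semigroup `V_t`, which is determined by
`tr[V_t(ρ) A] = tr[ρ Λ_t(A)]`. -/
structure IsFaithfulInvariantState (Λ : ℝ≥0 → ((H →L[ℂ] H) →L[ℂ] (H →L[ℂ] H)))
    (σ : H →L[ℂ] H) : Prop where
  state : IsState σ
  faithful : ∀ x, σ x = 0 → x = 0
  invariant : ∀ t A, tr (σ * Λ t A) = tr (σ * A)

/-- A faithful invariant state of the restriction of `Λ_t` to `Q L(H) Q ≅ L(ran Q)`, for a
projection `Q`. States on `ran Q` are regarded as operators `ρ = Q ρ Q` on `H`. -/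
structure IsFaithfulInvariantStateOn (Λ : ℝ≥0 → ((H →L[ℂ] H) →L[ℂ] (H →L[ℂ] H)))
    (Q ρ : H →L[ℂ] H) : Prop where
  state : IsState ρ
  supported : Q * ρ * Q = ρ
  faithful : ∀ x, Q x = x → ρ x = 0 → x = 0
  invariant : ∀ t A, tr (ρ * Λ t (Q * A * Q)) = tr (ρ * (Q * A * Q))

/-- The decoherence-free subalgebra of the semigroup. -/
def decoherenceFree (Λ : ℝ≥0 → ((H →L[ℂ] H) →L[ℂ] (H →L[ℂ] H))) : Set (H →L[ℂ] H) :=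
  {A | ∀ t, Λ t (star A * A) = star (Λ t A) * Λ t A ∧ Λ t (A * star A) = Λ t A * star (Λ t A)}

/-- `P` is a minimal projection of `C`. -/
structure IsMinimalProjection (C : Set (H →L[ℂ] H)) (P : H →L[ℂ] H) : Prop where
  mem : P ∈ C
  projection : IsStarProjection P
  ne_zero : P ≠ 0
  minimal : ∀ Q ∈ C, IsStarProjection Q → Q ≤ P → Q = 0 ∨ Q = P

/-- `(P_k)` is a resolution of the identity consisting of minimal projections of `C`. -/
structure IsMinimalResolution {I : Type*} [Fintype I] (C : Set (H →L[ℂ] H))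
    (P : I → (H →L[ℂ] H)) : Prop where
  minimal : ∀ k, IsMinimalProjection C (P k)
  orthogonal : ∀ k l, k ≠ l → P k * P l = 0
  sum_eq_one : ∑ k, P k = 1

/-- The map `Γ(A) = ∑ₖ tr[σₖ Pₖ A Pₖ] Pₖ`. -/
def condExpectation [FiniteDimensional ℂ H] {I : Type*} [Fintype I] (P τ : I → (H →L[ℂ] H)) :
    (H →L[ℂ] H) →L[ℂ] (H →L[ℂ] H) :=
  LinearMap.toContinuousLinearMap
    { toFun := fun A => ∑ k, tr (τ k * (P k * A * P k)) • P k
      map_add' := by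
        intro A B
        simp [tr, mul_add, add_mul, add_smul, Finset.sum_add_distrib]
      map_smul' := by
        intro c A
        simp [tr, mul_smul, Finset.smul_sum] }

/-- An observable with finite outcome set `Ω`, given by its effects `E(i) = E({i})`. -/
structure IsObservable {Ω : Type*} [Fintype Ω] (E : Ω → (H →L[ℂ] H)) : Prop where
  nonneg : ∀ i, 0 ≤ E i
  sum_eq_one : ∑ i, E i = 1

/-- Joint measurability of finite-outcome observables: existence of a joint observable. -/
def JointlyMeasurable {Ω₁ Ω₂ : Type*} [Fintype Ω₁] [Fintype Ω₂]
    (E : Ω₁ → (H →L[ℂ] H)) (F : Ω₂ → (H →L[ℂ] H)) : Prop :=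
  ∃ G : Ω₁ × Ω₂ → (H →L[ℂ] H), IsObservable G ∧
    (∀ i, ∑ j, G (i, j) = E i) ∧ (∀ j, ∑ i, G (i, j) = F j)

/-- Regularity of a finite-outcome observable relative to the algebra with minimal projections
`(P_k)`. -/
def IsRegular {I Ω : Type*} (P : I → (H →L[ℂ] H)) (E : Ω → (H →L[ℂ] H)) : Prop :=
  ∀ k i, P k * E i * P k ≠ 0

/-- `λ_E = min_{i,k} tr[σₖ Pₖ E(i) Pₖ]` (an infimum over a finite non-empty set of real
traces). -/
def lam {I Ω : Type*} (P τ : I → (H →L[ℂ] H)) (E : Ω → (H →L[ℂ] H)) : ℝ :=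
  ⨅ p : Ω × I, (tr (τ p.2 * (P p.2 * E p.1 * P p.2))).re

end

end OpenQuantum

/-!
The decoherence-free algebra `C` is abelian, so the orbit of a projection of `C` under `Λ` is a
continuous path of mutually commuting projections. Distinct commuting projections have distance at
least one, so every projection of `C`, in particular every `P k`, is fixed by the semigroup
(`map_eq_self_of_mem_decoherenceFree`). Hence each corner `P k L(H) P k` is invariant, and compressing
`σ` to it gives a faithful invariant state (`exists_isFaithfulInvariantStateOn`). The difference `X` of two
such states is an invariant self-adjoint operator of trace zero. The range projection of its
positive part is fixed by `Λ`, hence is a projection of `C` below the minimal `P k`, so it is `0` or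
`P k`; in either case `X = 0` (`eq_zero_of_forall_tr_mul_map_eq`).

For joint measurability, each `τ k` is invariant on all of `L(H)`, so `Γ ∘ Λ t = Γ`
(`condExpectation_map`), and the decay hypothesis says that `Λ t (E i)` and `Λ t (F j)` are within
`K exp (-γ t)` of `Γ (E i)` and `Γ (F j)`. The latter commute, being diagonal in the `P k`, and
`Γ (E i) Γ (F j) ≥ λ_E λ_F` (`smul_one_le_condExpectation_mul`). With `n₁ = |Ω₁|` and `n₂ = |Ω₂|`,

  `G (i, j) = Γ (E i) Γ (F j) + n₂⁻¹ (Λ t (E i) - Γ (E i)) + n₁⁻¹ (Λ t (F j) - Γ (F j))`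

has the required marginals, and it is positive as soon as `2 K exp (-γ t) ≤ λ_E λ_F`
(`jointlyMeasurable_of_norm_sub_le`). Only positivity and unitality of the maps `Λ t` enter.
-/

namespace OpenQuantum

open scoped ComplexOrder InnerProductSpace

/-! ### Positive maps and projections in C⋆-algebras -/

section CStar

theorem eq_of_commute_of_norm_sub_lt_one {A : Type*} [CStarAlgebra A] {p q : A}
    (hp : IsStarProjection p) (hq : IsStarProjection q) (hpq : p * q = q * p) (h : ‖p - q‖ < 1) :
    p = q := by
  -- For commuting projections `(p - q)³ = p - q`, so `‖p - q‖` is `0` or at least `1`.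
  have h3 : (p - q) * ((p - q) * (p - q)) = p - q := by
    have e1 := hp.isIdempotentElem.eq
    have e2 := hq.isIdempotentElem.eq
    have e3 : (p - q) * (p - q) = p + q - p * q - p * q := by
      rw [sub_mul, mul_sub, mul_sub, e1, e2, ← hpq]; abel
    have e4 : p * (p * q) = p * q := by rw [← mul_assoc, e1]
    have e5 : q * (p * q) = p * q := by rw [hpq, ← mul_assoc, e2]
    rw [e3, sub_mul, mul_sub, mul_sub, mul_add, mul_sub, mul_sub, mul_add, e1, e2, e4, e5, ← hpq]
    abel
  have hn : ‖(p - q)‖ ≤ ‖p - q‖ * (‖p - q‖ * ‖p - q‖) := by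
    calc ‖p - q‖ = ‖(p - q) * ((p - q) * (p - q))‖ := by rw [h3]
      _ ≤ _ := (norm_mul_le _ _).trans (by gcongr; exact norm_mul_le _ _)
  have h0 : ‖p - q‖ = 0 := by
    have := norm_nonneg (p - q)
    nlinarith [mul_nonneg this this]
  exact sub_eq_zero.mp (norm_eq_zero.mp h0)

variable {A : Type*} [CStarAlgebra A] [PartialOrder A] [StarOrderedRing A]

theorem mul_eq_zero_of_mul_mul_star_eq_zero {c b : A} (hb : 0 ≤ b) (h : c * b * star c = 0) :
    c * b = 0 := by
  obtain ⟨s, rfl⟩ := CStarAlgebra.nonneg_iff_eq_mul_star_self.mp hb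
  have h1 : (c * s) * star (c * s) = 0 := by
    rw [star_mul, ← h]; simp only [mul_assoc]
  rw [CStarRing.mul_star_self_eq_zero_iff] at h1
  rw [← mul_assoc, h1, zero_mul]

/-- Cauchy–Schwarz for a positive functional: the elements of its null space form a left ideal
annihilated by the functional. -/
theorem map_mul_eq_zero_of_map_star_mul_self {φ : A →ₗ[ℂ] ℂ} (hφ : ∀ b, 0 ≤ b → 0 ≤ φ b) {q : A}
    (hq : φ (star q * q) = 0) (a : A) : φ (a * q) = 0 := by
  let f : A →ₚ[ℂ] ℂ := PositiveLinearMap.mk₀ φ hφ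
  have h0 : ‖f.toPreGNS q‖ = 0 := by
    have h := f.preGNS_norm_sq (f.toPreGNS q)
    have h' : f (star q * q) = 0 := hq
    rw [f.ofPreGNS_toPreGNS, h'] at h
    exact_mod_cast (pow_eq_zero_iff two_ne_zero).mp h
  have h1 := norm_inner_le_norm (𝕜 := ℂ) (f.toPreGNS (star a)) (f.toPreGNS q)
  rw [h0, mul_zero, PositiveLinearMap.preGNS_inner_def] at h1
  have h2 := norm_le_zero_iff.mp h1
  rw [f.ofPreGNS_toPreGNS, f.ofPreGNS_toPreGNS, star_star] at h2
  exact h2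

theorem map_star_of_map_nonneg {B : Type*} [CStarAlgebra B] [PartialOrder B] [StarOrderedRing B]
    {φ : A →ₗ[ℂ] B} (hφ : ∀ b, 0 ≤ b → 0 ≤ φ b) (a : A) : φ (star a) = star (φ a) :=
  map_star (PositiveLinearMap.mk₀ φ hφ) a

/-- A positive functional that vanishes on `1 - p` only sees the corner of `p`. -/
theorem map_compress_of_map_projection {φ : A →ₗ[ℂ] ℂ} (hφ : ∀ b, 0 ≤ b → 0 ≤ φ b) {p : A}
    (hp : IsStarProjection p) (h : φ (1 - p) = 0) (a : A) : φ (p * a * p) = φ a := by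
  have hq : φ (star (1 - p) * (1 - p)) = 0 := by
    rw [hp.one_sub.isSelfAdjoint.star_eq, hp.one_sub.isIdempotentElem.eq, h]
  have h1 : ∀ b, φ (b * p) = φ b := fun b => by
    have := map_mul_eq_zero_of_map_star_mul_self hφ hq b
    rw [mul_sub, mul_one, map_sub, sub_eq_zero] at this
    exact this.symm
  have h2 : φ (p * a) = φ a := by
    have h3 := map_star_of_map_nonneg hφ (star a * p)
    rw [h1, star_mul, star_star, hp.isSelfAdjoint.star_eq, map_star_of_map_nonneg hφ,
      star_star] at h3
    exact h3
  rw [h1, h2]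

/-- A positive map that fixes a projection `p` preserves the corner of `p`: for `b ≥ 0`, the image
of `p * b * p` is dominated by a multiple of `p`, and positive elements span the algebra. Complete
positivity is not needed. -/
theorem compress_map_of_map_projection {Φ : A →ₗ[ℂ] A} (hΦ : ∀ b, 0 ≤ b → 0 ≤ Φ b) {p : A}
    (hp : IsStarProjection p) (h : Φ p = p) (a : A) :
    p * Φ (p * a * p) * p = Φ (p * a * p) := by
  have hpos : ∀ b : A, 0 ≤ b → p * Φ (p * b * p) * p = Φ (p * b * p) := by
    intro b hb
    have hc : 0 ≤ Φ (p * b * p) := hΦ _ (hp.isSelfAdjoint.conjugate_nonneg hb)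
    have hle : Φ (p * b * p) ≤ (‖b‖ : ℂ) • p := by
      have h1 : p * b * p ≤ (‖b‖ : ℂ) • p := by
        have h2 := hp.isSelfAdjoint.conjugate_le_conjugate
          (IsSelfAdjoint.le_algebraMap_norm_self (a := b))
        have h3 : p * algebraMap ℝ A ‖b‖ * p = (‖b‖ : ℂ) • p := by
          rw [Algebra.algebraMap_eq_smul_one, mul_smul_comm, smul_mul_assoc, mul_one,
            hp.isIdempotentElem.eq, Complex.coe_smul]
        rwa [h3] at h2
      have h2 := hΦ _ (sub_nonneg.mpr h1)
      rw [map_sub, map_smul, h, sub_nonneg] at h2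
      exact h2
    have hz : (1 - p) * Φ (p * b * p) = 0 := by
      apply mul_eq_zero_of_mul_mul_star_eq_zero hc
      rw [hp.one_sub.isSelfAdjoint.star_eq]
      refine le_antisymm ?_ (hp.one_sub.isSelfAdjoint.conjugate_nonneg hc)
      refine (hp.one_sub.isSelfAdjoint.conjugate_le_conjugate hle).trans_eq ?_
      rw [mul_smul_comm, hp.one_sub_mul_self, smul_zero, zero_mul]
    have h1 : p * Φ (p * b * p) = Φ (p * b * p) := by
      rw [sub_mul, one_mul, sub_eq_zero] at hz; exact hz.symm
    have h2 := congrArg star h1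
    rw [star_mul, hp.isSelfAdjoint.star_eq, (IsSelfAdjoint.of_nonneg hc).star_eq] at h2
    rw [h1, h2]
  have ha : a ∈ Submodule.span ℂ {b : A | 0 ≤ b} := by
    rw [CStarAlgebra.span_nonneg]; trivial
  induction ha using Submodule.span_induction with
  | mem b hb => exact hpos b hb
  | zero => simp
  | add x y _ _ hx hy => simp only [mul_add, add_mul, map_add, hx, hy]
  | smul c x _ hx => simp only [mul_smul_comm, smul_mul_assoc, map_smul, hx]

theorem add_nonneg_of_norm_le {a x : A} {c : ℝ} (ha : (c : ℂ) • (1 : A) ≤ a)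
    (hx : IsSelfAdjoint x) (hn : ‖x‖ ≤ c) : 0 ≤ a + x := by
  have h1 := hx.neg_algebraMap_norm_le_self
  have h2 : algebraMap ℝ A ‖x‖ ≤ algebraMap ℝ A c := algebraMap_mono A hn
  have h3 : algebraMap ℝ A c = (c : ℂ) • (1 : A) := by
    rw [Algebra.algebraMap_eq_smul_one, Complex.coe_smul]
  have h4 := add_le_add ha ((neg_le_neg h2).trans h1)
  rwa [h3, add_neg_cancel] at h4

end CStar

/-! ### The trace form on positive operators -/

section Trace

variable {H : Type*} [NormedAddCommGroup H] [InnerProductSpace ℂ H]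

theorem tr_add (A B : H →L[ℂ] H) : tr (A + B) = tr A + tr B := by simp [tr]

theorem tr_sub (A B : H →L[ℂ] H) : tr (A - B) = tr A - tr B := by simp [tr]

theorem tr_smul (c : ℂ) (A : H →L[ℂ] H) : tr (c • A) = c * tr A := by simp [tr]

theorem tr_mul_comm (A B : H →L[ℂ] H) : tr (A * B) = tr (B * A) :=
  LinearMap.trace_mul_comm ℂ (A : H →ₗ[ℂ] H) (B : H →ₗ[ℂ] H)

variable [CompleteSpace H]

theorem exists_tr_mul_eq_tr_star_mul_self {A B : H →L[ℂ] H} (hA : 0 ≤ A) (hB : 0 ≤ B) :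
    ∃ C : H →L[ℂ] H, tr (A * B) = tr (star C * C) ∧ (C = 0 → A * B = 0) := by
  obtain ⟨a, rfl⟩ := CStarAlgebra.nonneg_iff_eq_star_mul_self.mp hA
  obtain ⟨b, rfl⟩ := CStarAlgebra.nonneg_iff_eq_mul_star_self.mp hB
  refine ⟨a * b, ?_, fun h => ?_⟩
  · rw [star_mul, ← mul_assoc, tr_mul_comm]
    simp only [mul_assoc]
  · rw [mul_assoc, ← mul_assoc a, h, zero_mul, mul_zero]

variable [FiniteDimensional ℂ H]

theorem tr_star_mul_self (A : H →L[ℂ] H) :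
    tr (star A * A) = ((∑ i, ‖A (stdOrthonormalBasis ℂ H i)‖ ^ 2 : ℝ) : ℂ) := by
  rw [tr, LinearMap.trace_eq_sum_inner _ (stdOrthonormalBasis ℂ H), Complex.ofReal_sum]
  refine Finset.sum_congr rfl fun i _ => ?_
  change ⟪_, (ContinuousLinearMap.adjoint A) (A _)⟫_ℂ = _
  rw [ContinuousLinearMap.adjoint_inner_right, inner_self_eq_norm_sq_to_K]
  simp

theorem tr_star_mul_self_nonneg (A : H →L[ℂ] H) : 0 ≤ tr (star A * A) := by
  rw [tr_star_mul_self]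
  exact Complex.zero_le_real.mpr (Finset.sum_nonneg fun i _ => sq_nonneg _)

theorem eq_zero_of_tr_star_mul_self {A : H →L[ℂ] H} (h : tr (star A * A) = 0) : A = 0 := by
  rw [tr_star_mul_self] at h
  have h1 := (Finset.sum_eq_zero_iff_of_nonneg fun i _ => sq_nonneg _).mp
    (Complex.ofReal_eq_zero.mp h)
  have h2 : (A : H →ₗ[ℂ] H) = 0 := by
    refine (stdOrthonormalBasis ℂ H).toBasis.ext fun i => ?_
    simpa using h1 i (Finset.mem_univ i)
  exact ContinuousLinearMap.coe_injective h2

theorem tr_mul_nonneg {A B : H →L[ℂ] H} (hA : 0 ≤ A) (hB : 0 ≤ B) : 0 ≤ tr (A * B) := by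
  obtain ⟨C, hC, -⟩ := exists_tr_mul_eq_tr_star_mul_self hA hB
  exact hC ▸ tr_star_mul_self_nonneg C

theorem mul_eq_zero_of_tr_mul_eq_zero {A B : H →L[ℂ] H} (hA : 0 ≤ A) (hB : 0 ≤ B)
    (h : tr (A * B) = 0) : A * B = 0 := by
  obtain ⟨C, hC, hAB⟩ := exists_tr_mul_eq_tr_star_mul_self hA hB
  exact hAB (eq_zero_of_tr_star_mul_self (hC ▸ h))

theorem eq_zero_of_tr_eq_zero {A : H →L[ℂ] H} (hA : 0 ≤ A) (h : tr A = 0) : A = 0 := by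
  simpa using mul_eq_zero_of_tr_mul_eq_zero hA zero_le_one (by simpa using h)

/-- There is a projection `S` with the same left annihilator as `A`, namely the orthogonal
projection onto the range of `A`. -/
theorem exists_rangeProjection (A : H →L[ℂ] H) :
    ∃ S : H →L[ℂ] H, IsStarProjection S ∧ S * A = A ∧ ∀ Y : H →L[ℂ] H, Y * A = 0 → Y * S = 0 := by
  let U : Submodule ℂ H := LinearMap.range (A : H →ₗ[ℂ] H)
  refine ⟨U.starProjection, isStarProjection_starProjection, ?_, fun Y hY => ?_⟩
  · ext x
    exact Submodule.starProjection_eq_self_iff.mpr ⟨x, rfl⟩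
  · ext x
    obtain ⟨y, hy⟩ := U.starProjection_apply_mem x
    have := congrArg (fun Z : H →L[ℂ] H => Z y) hY
    change Y (U.starProjection x) = 0
    rw [← hy]
    exact this

end Trace

/-! ### Projections fixed by the semigroup -/

section Semigroup

variable {H : Type*} [NormedAddCommGroup H] [InnerProductSpace ℂ H] [CompleteSpace H]

/-- Complete positivity at matrix size `1` is positivity. -/
theorem IsCompletelyPositive.map_nonneg {Φ : (H →L[ℂ] H) →L[ℂ] (H →L[ℂ] H)}
    (hΦ : IsCompletelyPositive Φ) (A : H →L[ℂ] H) (hA : 0 ≤ A) : 0 ≤ Φ A := by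
  obtain ⟨a, rfl⟩ := CStarAlgebra.nonneg_iff_eq_star_mul_self.mp hA
  let M : CStarMatrix (Fin 1) (Fin 1) (H →L[ℂ] H) := CStarMatrix.ofMatrix fun _ _ => a
  have h := hΦ 1 _ (star_mul_self_nonneg M)
  -- The single entry of a positive `1 × 1` matrix is positive.
  have key : ∀ N : CStarMatrix (Fin 1) (Fin 1) (H →L[ℂ] H), 0 ≤ N → 0 ≤ N 0 0 := by
    intro N hN
    rw [StarOrderedRing.nonneg_iff] at hN
    induction hN using AddSubmonoid.closure_induction with
    | mem x hx =>
      obtain ⟨y, rfl⟩ := hx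
      simp only [CStarMatrix.mul_apply, Fin.sum_univ_one, CStarMatrix.star_apply]
      exact star_mul_self_nonneg _
    | zero => exact le_rfl
    | add x y _ _ hx hy => exact add_nonneg hx hy
  have h1 := key _ h
  rw [CStarMatrix.map_apply, CStarMatrix.mul_apply, Fin.sum_univ_one, CStarMatrix.star_apply] at h1
  exact h1

variable {Λ : ℝ≥0 → ((H →L[ℂ] H) →L[ℂ] (H →L[ℂ] H))}

theorem IsUniformlyContinuousSemigroup.map_nonneg (hΛ : IsUniformlyContinuousSemigroup Λ)
    (t : ℝ≥0) (A : H →L[ℂ] H) (hA : 0 ≤ A) : 0 ≤ Λ t A :=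
  (hΛ.channel t).completelyPositive.map_nonneg A hA

theorem IsUniformlyContinuousSemigroup.map_star (hΛ : IsUniformlyContinuousSemigroup Λ)
    (t : ℝ≥0) (A : H →L[ℂ] H) : Λ t (star A) = star (Λ t A) :=
  map_star_of_map_nonneg (φ := (Λ t : (H →L[ℂ] H) →ₗ[ℂ] (H →L[ℂ] H))) (hΛ.map_nonneg t) A

/-- For a projection `p`, both multiplicativity conditions say that `Λ t p` is idempotent. -/
theorem mem_decoherenceFree_iff_of_isStarProjection (hΛ : IsUniformlyContinuousSemigroup Λ)
    {p : H →L[ℂ] H} (hp : IsStarProjection p) :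
    p ∈ decoherenceFree Λ ↔ ∀ t, IsStarProjection (Λ t p) := by
  have hs : ∀ t, star (Λ t p) = Λ t p := fun t => by
    rw [← hΛ.map_star, hp.isSelfAdjoint.star_eq]
  constructor
  · intro h t
    have h1 := (h t).1
    rw [hp.isSelfAdjoint.star_eq, hp.isIdempotentElem.eq, hs] at h1
    exact ⟨h1.symm, hs t⟩
  · intro h t
    rw [hp.isSelfAdjoint.star_eq, hp.isIdempotentElem.eq, hs, (h t).isIdempotentElem.eq]
    exact ⟨rfl, rfl⟩

/-- The orbit of `p` is a norm-continuous path of projections in the decoherence-free algebra, hence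
of mutually commuting ones when that algebra is abelian. Distinct commuting projections are at
distance at least `1`, so the path is constant. -/
theorem map_eq_self_of_mem_decoherenceFree (hΛ : IsUniformlyContinuousSemigroup Λ)
    (hab : ∀ A ∈ decoherenceFree Λ, ∀ B ∈ decoherenceFree Λ, A * B = B * A)
    {p : H →L[ℂ] H} (hp : IsStarProjection p) (hpC : p ∈ decoherenceFree Λ) (t : ℝ≥0) :
    Λ t p = p := by
  have hproj := (mem_decoherenceFree_iff_of_isStarProjection hΛ hp).mp hpC
  have hmem : ∀ s, Λ s p ∈ decoherenceFree Λ := fun s => by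
    rw [mem_decoherenceFree_iff_of_isStarProjection hΛ (hproj s)]
    intro r
    have := hproj (s + r)
    rwa [hΛ.add] at this
  have hcont : Continuous fun s => Λ s p := hΛ.continuous.clm_apply continuous_const
  have hloc : IsLocallyConstant fun s => Λ s p := by
    rw [IsLocallyConstant.iff_eventually_eq]
    intro s
    filter_upwards [hcont.continuousAt.eventually (Metric.ball_mem_nhds (Λ s p) one_pos)] with r hr
    exact eq_of_commute_of_norm_sub_lt_one (hproj r) (hproj s)
      (hab _ (hmem r) _ (hmem s)) (by simpa [dist_eq_norm] using hr)
  have h := hloc.apply_eq_of_preconnectedSpace t 0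
  simpa [hΛ.zero] using h

variable [FiniteDimensional ℂ H]

/-- A faithful invariant state turns subinvariance into invariance. -/
theorem IsFaithfulInvariantState.eq_of_le {σ : H →L[ℂ] H} (hσ : IsFaithfulInvariantState Λ σ)
    {t : ℝ≥0} {A : H →L[ℂ] H} (h : A ≤ Λ t A) : Λ t A = A := by
  have h0 : tr (σ * (Λ t A - A)) = 0 := by
    rw [mul_sub, tr_sub, hσ.invariant, sub_self]
  have h1 := mul_eq_zero_of_tr_mul_eq_zero hσ.state.1 (sub_nonneg.mpr h) h0
  rw [← sub_eq_zero]
  ext x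
  exact hσ.faithful _ (congrArg (fun Z : H →L[ℂ] H => Z x) h1)

/-- The range projection `S` of `X⁺` maximizes `A ↦ tr (X * A)` over effects, and invariance of `X`
makes `Λ t S` another maximizer. This forces `S ≤ Λ t S`, so `S` is fixed and lies in the
decoherence-free algebra. By minimality of `p` one of `X⁺`, `X⁻` vanishes, and then `tr X = 0` kills the other. -/
theorem eq_zero_of_forall_tr_mul_map_eq (hΛ : IsUniformlyContinuousSemigroup Λ)
    {σ : H →L[ℂ] H} (hσ : IsFaithfulInvariantState Λ σ)
    {p X : H →L[ℂ] H} (hp : IsMinimalProjection (decoherenceFree Λ) p)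
    (hX : IsSelfAdjoint X) (hpX : p * X * p = X) (htr : tr X = 0)
    (hinv : ∀ t A, tr (X * Λ t (p * A * p)) = tr (X * (p * A * p))) : X = 0 := by
  have hpp := hp.projection.isIdempotentElem.eq
  have hpX1 : p * X = X := by rw [← hpX]; simp only [← mul_assoc, hpp]
  have hXp : X * p = X := by rw [← hpX]; simp only [mul_assoc, hpp]
  have hdec : X⁺ - X⁻ = X := CFC.posPart_sub_negPart X hX
  have hpos := CFC.posPart_nonneg X
  have hneg := CFC.negPart_nonneg X
  have hnp : X⁻ * X⁺ = 0 := CFC.negPart_mul_posPart X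
  have hzero : X⁻ = 0 ∨ X⁺ = 0 → X = 0 := by
    rintro (h | h)
    · rw [h, sub_zero] at hdec
      rw [← hdec]; rw [← hdec] at htr
      exact eq_zero_of_tr_eq_zero hpos htr
    · rw [h, zero_sub] at hdec
      rw [← hdec, neg_eq_zero]
      refine eq_zero_of_tr_eq_zero hneg ?_
      rw [← hdec, ← zero_sub, tr_sub] at htr
      simpa [tr] using htr
  have hq : (1 - p) * X⁺ = 0 := by
    have hsq : (1 - p) * (X⁺ * X⁺) = 0 := by
      have : X⁺ * X⁺ = X * X⁺ := by
        have := congrArg (· * X⁺) hdec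
        simpa [sub_mul, hnp] using this
      rw [this, ← mul_assoc, sub_mul, one_mul, hpX1, sub_self, zero_mul]
    rw [← CStarRing.mul_star_self_eq_zero_iff, star_mul, (IsSelfAdjoint.of_nonneg hpos).star_eq,
      mul_assoc, ← mul_assoc X⁺, ← mul_assoc, hsq, zero_mul]
  obtain ⟨S, hS, hSX, hSann⟩ := exists_rangeProjection X⁺
  have hXS : X⁺ * S = X⁺ := by
    have := congrArg star hSX
    rwa [star_mul, hS.isSelfAdjoint.star_eq, (IsSelfAdjoint.of_nonneg hpos).star_eq] at this
  have hnS : X⁻ * S = 0 := hSann _ hnp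
  have hpS : p * S = S := by
    have := hSann _ hq
    rwa [sub_mul, one_mul, sub_eq_zero, eq_comm] at this
  have hSp : S * p = S := by
    have := congrArg star hpS
    rwa [star_mul, hS.isSelfAdjoint.star_eq, hp.projection.isSelfAdjoint.star_eq] at this
  have hfix : ∀ t, Λ t S = S := by
    intro t
    have hT0 : 0 ≤ Λ t S := hΛ.map_nonneg t _ hS.nonneg
    have hT1 : 0 ≤ 1 - Λ t S := by
      have := hΛ.map_nonneg t _ hS.one_sub_nonneg
      rwa [map_sub, (hΛ.channel t).unital] at this
    have h1 := hinv t S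
    rw [hpS, hSp, ← hdec, sub_mul, sub_mul, tr_sub, tr_sub, hXS, hnS] at h1
    -- `tr X⁺ = tr (X⁺ Λ_t(S)) - tr (X⁻ Λ_t(S))` is a vanishing sum of two nonnegative terms.
    have h2 : tr (X⁺ * (1 - Λ t S)) + tr (X⁻ * Λ t S) = 0 := by
      rw [mul_sub, mul_one, tr_sub]
      have h0 : tr (0 : H →L[ℂ] H) = 0 := by simp [tr]
      rw [h0] at h1
      linear_combination -h1
    have h3 : X⁺ * (1 - Λ t S) = 0 := mul_eq_zero_of_tr_mul_eq_zero hpos hT1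
      ((add_eq_zero_iff_of_nonneg (tr_mul_nonneg hpos hT1) (tr_mul_nonneg hneg hT0)).mp h2).1
    have h4 : (1 - Λ t S) * S = 0 := by
      apply hSann
      have := congrArg star h3
      rwa [star_mul, star_zero, (IsSelfAdjoint.of_nonneg hT1).star_eq,
        (IsSelfAdjoint.of_nonneg hpos).star_eq] at this
    have h5 : Λ t S * S = S := by
      rwa [sub_mul, one_mul, sub_eq_zero, eq_comm] at h4
    have h6 : S * Λ t S = S := by
      have := congrArg star h5
      rwa [star_mul, hS.isSelfAdjoint.star_eq, (IsSelfAdjoint.of_nonneg hT0).star_eq] at this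
    apply hσ.eq_of_le
    have h7 : (1 - S) * Λ t S * (1 - S) = Λ t S - S := by
      rw [sub_mul, one_mul, h6, mul_sub, mul_one, sub_mul, h5, hS.isIdempotentElem.eq, sub_self,
        sub_zero]
    rw [← sub_nonneg, ← h7]
    exact hS.one_sub.isSelfAdjoint.conjugate_nonneg hT0
  have hSC : S ∈ decoherenceFree Λ :=
    (mem_decoherenceFree_iff_of_isStarProjection hΛ hS).mpr fun t => by rwa [hfix t]
  rcases hp.minimal S hSC hS (hS.le_of_mul_eq_left hp.projection hSp) with h | h
  · exact hzero (Or.inr (by rw [← hSX, h, zero_mul]))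
  · rw [h] at hXS hnS
    refine hzero (Or.inl ?_)
    have hXp' : X⁺ * p - X⁻ * p = X⁺ - X⁻ := by rw [← sub_mul, hdec, hXp]
    rw [hXS, hnS, sub_zero] at hXp'
    exact (sub_eq_self.mp hXp'.symm)

end Semigroup

/-! ### Invariant states on the blocks -/

section States

variable {H : Type*} [NormedAddCommGroup H] [InnerProductSpace ℂ H]
  {Λ : ℝ≥0 → ((H →L[ℂ] H) →L[ℂ] (H →L[ℂ] H))} {σ p : H →L[ℂ] H}

theorem IsFaithfulInvariantStateOn.tr_mul_compress {τ : H →L[ℂ] H}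
    (hτ : IsFaithfulInvariantStateOn Λ p τ) (A : H →L[ℂ] H) :
    tr (τ * (p * A * p)) = tr (τ * A) := by
  conv_rhs => rw [← hτ.supported]
  rw [← mul_assoc, tr_mul_comm]
  simp only [mul_assoc]

variable [CompleteSpace H] [FiniteDimensional ℂ H]

/-- The normalized compression of `σ` to the corner of `p`. -/
theorem exists_isFaithfulInvariantStateOn (hΛ : IsUniformlyContinuousSemigroup Λ)
    (hσ : IsFaithfulInvariantState Λ σ) (hp : IsStarProjection p) (hp0 : p ≠ 0)
    (hfix : ∀ t, Λ t p = p) : ∃ ρ, IsFaithfulInvariantStateOn Λ p ρ := by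
  have hpp := hp.isIdempotentElem.eq
  have hcomp : 0 ≤ p * σ * p := hp.isSelfAdjoint.conjugate_nonneg hσ.state.1
  have hfaith : ∀ x, p x = x → (p * σ * p) x = 0 → x = 0 := by
    -- With `σ = star s * s`, the vanishing of `⟪x, p σ p x⟫ = ‖s x‖²` gives `σ x = 0`.
    obtain ⟨s, hs⟩ := CStarAlgebra.nonneg_iff_eq_star_mul_self.mp hσ.state.1
    intro x hx h0
    have h1 : s x = 0 := by
      have h2 : ⟪x, (p * σ * p) x⟫_ℂ = ⟪s x, s x⟫_ℂ := by
        have e1 : (p * σ * p) x = p ((ContinuousLinearMap.adjoint s) (s (p x))) := by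
          rw [hs]; rfl
        have e2 : ContinuousLinearMap.adjoint p = p := hp.isSelfAdjoint.star_eq
        rw [e1, ← ContinuousLinearMap.adjoint_inner_left, e2, hx,
          ContinuousLinearMap.adjoint_inner_right]
      rw [h0, inner_zero_right] at h2
      exact inner_self_eq_zero.mp h2.symm
    apply hσ.faithful
    have e1 : σ x = (star s) (s x) := by rw [hs]; rfl
    rw [e1, h1, map_zero]
  have htr0 : tr (p * σ * p) ≠ 0 := by
    intro h
    have h1 := eq_zero_of_tr_eq_zero hcomp h
    apply hp0
    ext x
    refine hfaith (p x) ?_ (by rw [h1]; rfl)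
    exact congrArg (fun Z : H →L[ℂ] H => Z x) hpp
  have htr : 0 ≤ tr (p * σ * p) := by
    simpa using tr_mul_nonneg hcomp zero_le_one
  refine ⟨(tr (p * σ * p))⁻¹ • (p * σ * p), ⟨smul_nonneg (inv_nonneg.mpr htr) hcomp, ?_⟩,
    ?_, ?_, ?_⟩
  · rw [tr_smul, inv_mul_cancel₀ htr0]
  · rw [mul_smul_comm, smul_mul_assoc]
    congr 1
    simp only [mul_assoc, hpp]
    rw [← mul_assoc p p, hpp]
  · intro x hx h0
    refine hfaith x hx ?_
    exact (smul_eq_zero.mp h0).resolve_left (inv_ne_zero htr0)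
  · intro t A
    have h1 : ∀ B : H →L[ℂ] H, tr (p * σ * p * B) = tr (σ * (p * B * p)) := fun B => by
      rw [mul_assoc, mul_assoc, tr_mul_comm]
      simp only [mul_assoc]
    rw [smul_mul_assoc, smul_mul_assoc, tr_smul, tr_smul, h1, h1]
    have h2 := compress_map_of_map_projection
      (Φ := (Λ t : (H →L[ℂ] H) →ₗ[ℂ] (H →L[ℂ] H))) (hΛ.map_nonneg t) hp (hfix t) A
    have h3 : p * Λ t (p * A * p) * p = Λ t (p * A * p) := h2
    have h4 : p * (p * A * p) * p = p * A * p := by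
      simp only [mul_assoc, hpp]
      rw [← mul_assoc p p, hpp]
    rw [h3, h4, hσ.invariant]

theorem IsFaithfulInvariantStateOn.eq (hΛ : IsUniformlyContinuousSemigroup Λ)
    (hσ : IsFaithfulInvariantState Λ σ) (hp : IsMinimalProjection (decoherenceFree Λ) p)
    {ρ τ : H →L[ℂ] H} (hρ : IsFaithfulInvariantStateOn Λ p ρ)
    (hτ : IsFaithfulInvariantStateOn Λ p τ) : ρ = τ := by
  rw [← sub_eq_zero]
  refine eq_zero_of_forall_tr_mul_map_eq hΛ hσ hp
    ((IsSelfAdjoint.of_nonneg hρ.state.1).sub (IsSelfAdjoint.of_nonneg hτ.state.1)) ?_ ?_ ?_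
  · rw [mul_sub, sub_mul, hρ.supported, hτ.supported]
  · rw [tr_sub, hρ.state.2, hτ.state.2, sub_self]
  · intro t A
    rw [sub_mul, sub_mul, tr_sub, tr_sub, hρ.invariant, hτ.invariant]

/-- An invariant state of a corner is invariant on all of `L(H)`: the state `A ↦ tr (τ * Λ t A)` is
still concentrated on `p`, because `Λ t` fixes `p`. -/
theorem IsFaithfulInvariantStateOn.tr_mul_map (hΛ : IsUniformlyContinuousSemigroup Λ)
    (hp : IsStarProjection p) (hfix : ∀ t, Λ t p = p) {τ : H →L[ℂ] H}
    (hτ : IsFaithfulInvariantStateOn Λ p τ) (t : ℝ≥0) (A : H →L[ℂ] H) :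
    tr (τ * Λ t A) = tr (τ * A) := by
  let φ : (H →L[ℂ] H) →ₗ[ℂ] ℂ :=
    { toFun := fun B => tr (τ * Λ t B)
      map_add' := fun B C => by rw [map_add, mul_add, tr_add]
      map_smul' := fun c B => by rw [map_smul, mul_smul_comm, tr_smul]; rfl }
  have hφ : ∀ B, 0 ≤ B → 0 ≤ φ B := fun B hB =>
    tr_mul_nonneg hτ.state.1 (hΛ.map_nonneg t B hB)
  have h0 : φ (1 - p) = 0 := by
    change tr (τ * Λ t (1 - p)) = 0
    rw [map_sub, (hΛ.channel t).unital, hfix t, ← hτ.tr_mul_compress, hp.mul_one_sub_self,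
      zero_mul, mul_zero]
    simp [tr]
  have h1 : tr (τ * Λ t (p * A * p)) = tr (τ * Λ t A) := map_compress_of_map_projection hφ hp h0 A
  rw [← h1, hτ.invariant, hτ.tr_mul_compress]

theorem IsFaithfulInvariantStateOn.tr_mul_compress_pos {τ : H →L[ℂ] H}
    (hp : IsStarProjection p)
    (hτ : IsFaithfulInvariantStateOn Λ p τ) {A : H →L[ℂ] H} (hA : 0 ≤ A) (h : p * A * p ≠ 0) :
    0 < tr (τ * (p * A * p)) := by
  have hc : 0 ≤ p * A * p := hp.isSelfAdjoint.conjugate_nonneg hA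
  refine lt_of_le_of_ne (tr_mul_nonneg hτ.state.1 hc) fun h0 => h ?_
  have h1 := mul_eq_zero_of_tr_mul_eq_zero hτ.state.1 hc h0.symm
  ext x
  refine hτ.faithful _ ?_ (congrArg (fun Z : H →L[ℂ] H => Z x) h1)
  have h2 : p * (p * A * p) = p * A * p := by
    simp only [← mul_assoc, hp.isIdempotentElem.eq]
  exact congrArg (fun Z : H →L[ℂ] H => Z x) h2

end States

/-! ### The conditional expectation onto the span of the blocks -/

section CondExpectation

variable {H : Type*} [NormedAddCommGroup H] [InnerProductSpace ℂ H] [FiniteDimensional ℂ H]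
  {I : Type*} [Fintype I] {P τ : I → (H →L[ℂ] H)}

theorem condExpectation_apply (A : H →L[ℂ] H) :
    condExpectation P τ A = ∑ k, tr (τ k * (P k * A * P k)) • P k := rfl

variable {Λ : ℝ≥0 → ((H →L[ℂ] H) →L[ℂ] (H →L[ℂ] H))}

theorem condExpectation_one (hsum : ∑ k, P k = 1)
    (hτ : ∀ k, IsFaithfulInvariantStateOn Λ (P k) (τ k)) :
    condExpectation P τ (1 : H →L[ℂ] H) = 1 := by
  rw [condExpectation_apply, ← hsum]
  refine Finset.sum_congr rfl fun k _ => ?_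
  rw [(hτ k).tr_mul_compress, hsum, mul_one, (hτ k).state.2, one_smul]

variable [CompleteSpace H]

theorem condExpectation_map (hΛ : IsUniformlyContinuousSemigroup Λ)
    (hP : ∀ k, IsStarProjection (P k)) (hfix : ∀ k t, Λ t (P k) = P k)
    (hτ : ∀ k, IsFaithfulInvariantStateOn Λ (P k) (τ k)) (t : ℝ≥0) (A : H →L[ℂ] H) :
    condExpectation P τ (Λ t A) = condExpectation P τ A := by
  rw [condExpectation_apply, condExpectation_apply]
  refine Finset.sum_congr rfl fun k _ => ?_
  rw [(hτ k).tr_mul_compress, (hτ k).tr_mul_compress,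
    (hτ k).tr_mul_map hΛ (hP k) (hfix k)]

theorem IsObservable.condExpectation (hP : ∀ k, IsStarProjection (P k)) (hsum : ∑ k, P k = 1)
    (hτ : ∀ k, IsFaithfulInvariantStateOn Λ (P k) (τ k)) {Ω : Type*} [Fintype Ω]
    {E : Ω → (H →L[ℂ] H)} (hE : IsObservable E) :
    IsObservable fun i => condExpectation P τ (E i) where
  nonneg i := by
    rw [condExpectation_apply]
    exact Finset.sum_nonneg fun k _ => smul_nonneg
      (tr_mul_nonneg (hτ k).state.1 ((hP k).isSelfAdjoint.conjugate_nonneg (hE.nonneg i)))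
      (hP k).nonneg
  sum_eq_one := by
    rw [← map_sum, hE.sum_eq_one, condExpectation_one hsum hτ]

theorem condExpectation_mul_condExpectation (hP : ∀ k, IsStarProjection (P k))
    (horth : ∀ k l, k ≠ l → P k * P l = 0) (A B : H →L[ℂ] H) :
    condExpectation P τ A * condExpectation P τ B =
      ∑ k, (tr (τ k * (P k * A * P k)) * tr (τ k * (P k * B * P k))) • P k := by
  classical
  rw [condExpectation_apply, condExpectation_apply, Finset.sum_mul]
  refine Finset.sum_congr rfl fun k _ => ?_
  rw [Finset.mul_sum, Finset.sum_eq_single k]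
  · rw [smul_mul_smul_comm, (hP k).isIdempotentElem.eq]
  · intro l _ hl
    rw [smul_mul_smul_comm, horth k l hl.symm, smul_zero]
  · simp

variable {Ω : Type*} [Fintype Ω] {E : Ω → (H →L[ℂ] H)}

theorem lam_le_tr (hP : ∀ k, IsStarProjection (P k))
    (hτ : ∀ k, IsFaithfulInvariantStateOn Λ (P k) (τ k)) (hE : IsObservable E) (i : Ω) (k : I) :
    (lam P τ E : ℂ) ≤ tr (τ k * (P k * E i * P k)) := by
  have h0 := tr_mul_nonneg (hτ k).state.1
    ((hP k).isSelfAdjoint.conjugate_nonneg (hE.nonneg i))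
  have hre : tr (τ k * (P k * E i * P k)) = ((tr (τ k * (P k * E i * P k))).re : ℂ) :=
    Complex.eq_re_of_ofReal_le (r := 0) (by simpa using h0)
  rw [hre]
  exact Complex.real_le_real.mpr (ciInf_le (Set.finite_range _).bddBelow ((i, k) : Ω × I))

theorem lam_pos [Nonempty Ω] [Nonempty I] (hP : ∀ k, IsStarProjection (P k))
    (hτ : ∀ k, IsFaithfulInvariantStateOn Λ (P k) (τ k)) (hE : IsObservable E)
    (hreg : IsRegular P E) : 0 < lam P τ E := by
  obtain ⟨⟨i, k⟩, h⟩ := exists_eq_ciInf_of_finite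
    (f := fun q : Ω × I => (tr (τ q.2 * (P q.2 * E q.1 * P q.2))).re)
  rw [lam, ← h]
  exact (Complex.pos_iff.mp ((hτ k).tr_mul_compress_pos (hP k) (hE.nonneg i) (hreg k i))).1

/-- On each block `P k` the product is a scalar that is at least `λ_E λ_F`. -/
theorem smul_one_le_condExpectation_mul [Nonempty Ω] [Nonempty I]
    {Ω' : Type*} [Fintype Ω'] [Nonempty Ω'] {F : Ω' → (H →L[ℂ] H)}
    (hP : ∀ k, IsStarProjection (P k))
    (horth : ∀ k l, k ≠ l → P k * P l = 0) (hsum : ∑ k, P k = 1)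
    (hτ : ∀ k, IsFaithfulInvariantStateOn Λ (P k) (τ k))
    (hE : IsObservable E) (hF : IsObservable F) (hEreg : IsRegular P E) (hFreg : IsRegular P F)
    (i : Ω) (j : Ω') :
    ((lam P τ E * lam P τ F : ℝ) : ℂ) • (1 : H →L[ℂ] H) ≤
      condExpectation P τ (E i) * condExpectation P τ (F j) := by
  rw [condExpectation_mul_condExpectation hP horth, ← hsum, Finset.smul_sum]
  refine Finset.sum_le_sum fun k _ => ?_
  have hE0 : (0 : ℂ) ≤ lam P τ E := Complex.zero_le_real.mpr (lam_pos hP hτ hE hEreg).le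
  have hF0 : (0 : ℂ) ≤ lam P τ F := Complex.zero_le_real.mpr (lam_pos hP hτ hF hFreg).le
  have hEk := lam_le_tr hP hτ hE i k
  rw [Complex.ofReal_mul]
  exact smul_le_smul_of_nonneg_right
    (mul_le_mul hEk (lam_le_tr hP hτ hF j k) hF0 (hE0.trans hEk)) (hP k).nonneg

end CondExpectation

/-! ### Joint measurability near a commuting pair -/

section JointMeasurability

variable {H : Type*} [NormedAddCommGroup H] [InnerProductSpace ℂ H] [CompleteSpace H]
  {Ω₁ Ω₂ : Type*} [Fintype Ω₁] [Fintype Ω₂]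

theorem IsObservable.norm_le_one {E : Ω₁ → (H →L[ℂ] H)} (hE : IsObservable E) (i : Ω₁) :
    ‖E i‖ ≤ 1 := by
  rw [CStarAlgebra.norm_le_one_iff_of_nonneg _ (hE.nonneg i), ← hE.sum_eq_one]
  exact Finset.single_le_sum (fun j _ => hE.nonneg j) (Finset.mem_univ i)

theorem IsObservable.map {Φ : (H →L[ℂ] H) →L[ℂ] (H →L[ℂ] H)} (hΦ : IsHeisenbergChannel Φ)
    {E : Ω₁ → (H →L[ℂ] H)} (hE : IsObservable E) : IsObservable fun i => Φ (E i) where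
  nonneg i := hΦ.completelyPositive.map_nonneg _ (hE.nonneg i)
  sum_eq_one := by rw [← map_sum, hE.sum_eq_one, hΦ.unital]

theorem nonempty_of_sum_eq_one {H : Type*} [NormedAddCommGroup H] [InnerProductSpace ℂ H]
    [Nontrivial H] {E : Ω₁ → (H →L[ℂ] H)} (hE : ∑ i, E i = 1) :
    Nonempty Ω₁ := by
  by_contra h
  rw [not_nonempty_iff] at h
  rw [Finset.univ_eq_empty, Finset.sum_empty] at hE
  exact zero_ne_one hE

/-- Two observables are jointly measurable when they are close, relative to `c`, to a pair whose
products `E₀ i * F₀ j` are bounded below by `c`. The products are a joint observable for `E₀` and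
`F₀`; adding the perturbations `E i - E₀ i` and `F j - F₀ j`, spread evenly over the other index,
corrects the marginals, and the lower bound absorbs the loss of positivity. -/
theorem jointlyMeasurable_of_norm_sub_le [Nonempty Ω₁] [Nonempty Ω₂]
    {E E₀ : Ω₁ → (H →L[ℂ] H)} {F F₀ : Ω₂ → (H →L[ℂ] H)}
    (hE : IsObservable E) (hF : IsObservable F) (hE₀ : IsObservable E₀) (hF₀ : IsObservable F₀)
    {c ε : ℝ} (hc : ∀ i j, (c : ℂ) • (1 : H →L[ℂ] H) ≤ E₀ i * F₀ j)
    (hEε : ∀ i, ‖E i - E₀ i‖ ≤ ε) (hFε : ∀ j, ‖F j - F₀ j‖ ≤ ε) (hε : 2 * ε ≤ c) :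
    JointlyMeasurable E F := by
  let G : Ω₁ × Ω₂ → (H →L[ℂ] H) := fun q => E₀ q.1 * F₀ q.2 +
    ((Fintype.card Ω₂ : ℝ)⁻¹ • (E q.1 - E₀ q.1) + (Fintype.card Ω₁ : ℝ)⁻¹ • (F q.2 - F₀ q.2))
  have hc₁ : (Fintype.card Ω₁ : ℝ) ≠ 0 := Nat.cast_ne_zero.mpr Fintype.card_ne_zero
  have hc₂ : (Fintype.card Ω₂ : ℝ) ≠ 0 := Nat.cast_ne_zero.mpr Fintype.card_ne_zero
  have hG₁ : ∀ i, ∑ j, G (i, j) = E i := fun i => by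
    simp only [G, Finset.sum_add_distrib, ← Finset.mul_sum, ← Finset.smul_sum,
      Finset.sum_sub_distrib, hF.sum_eq_one, hF₀.sum_eq_one, sub_self, smul_zero, add_zero,
      mul_one, Finset.sum_const, Finset.card_univ]
    rw [← Nat.cast_smul_eq_nsmul ℝ, ← Nat.cast_smul_eq_nsmul ℝ, ← smul_sub, smul_smul,
      inv_mul_cancel₀ hc₂, one_smul, add_sub_cancel]
  have hG₂ : ∀ j, ∑ i, G (i, j) = F j := fun j => by
    simp only [G, Finset.sum_add_distrib, ← Finset.sum_mul, ← Finset.smul_sum,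
      Finset.sum_sub_distrib, hE.sum_eq_one, hE₀.sum_eq_one, sub_self, smul_zero, zero_add,
      one_mul, Finset.sum_const, Finset.card_univ]
    rw [← Nat.cast_smul_eq_nsmul ℝ, ← Nat.cast_smul_eq_nsmul ℝ, ← smul_sub, smul_smul,
      inv_mul_cancel₀ hc₁, one_smul, add_sub_cancel]
  have hinv : ∀ n : ℕ, ‖(n : ℝ)⁻¹‖ ≤ 1 := fun n => by
    rw [norm_inv, Real.norm_natCast]
    exact Nat.cast_inv_le_one n
  refine ⟨G, ⟨fun q => ?_, ?_⟩, hG₁, hG₂⟩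
  · have hsaE := (IsSelfAdjoint.of_nonneg (hE.nonneg q.1)).sub
      (IsSelfAdjoint.of_nonneg (hE₀.nonneg q.1))
    have hsaF := (IsSelfAdjoint.of_nonneg (hF.nonneg q.2)).sub
      (IsSelfAdjoint.of_nonneg (hF₀.nonneg q.2))
    have hn : ‖(Fintype.card Ω₂ : ℝ)⁻¹ • (E q.1 - E₀ q.1) +
        (Fintype.card Ω₁ : ℝ)⁻¹ • (F q.2 - F₀ q.2)‖ ≤ c := by
      refine (norm_add_le _ _).trans ?_
      rw [norm_smul, norm_smul]
      have h1 := mul_le_mul (hinv (Fintype.card Ω₂)) (hEε q.1) (norm_nonneg _) zero_le_one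
      have h2 := mul_le_mul (hinv (Fintype.card Ω₁)) (hFε q.2) (norm_nonneg _) zero_le_one
      linarith
    exact add_nonneg_of_norm_le (hc q.1 q.2)
      (((IsSelfAdjoint.all (Fintype.card Ω₂ : ℝ)⁻¹).smul hsaE).add
        ((IsSelfAdjoint.all (Fintype.card Ω₁ : ℝ)⁻¹).smul hsaF)) hn
  · rw [Fintype.sum_prod_type]
    simp only [hG₁, hE.sum_eq_one]

end JointMeasurability

end OpenQuantum

theorem mainTheorem1 {H : Type*} [NormedAddCommGroup H] [InnerProductSpace ℂ H]
    [CompleteSpace H] [FiniteDimensional ℂ H]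
    (Λ : ℝ≥0 → ((H →L[ℂ] H) →L[ℂ] (H →L[ℂ] H)))
    (hΛ : OpenQuantum.IsUniformlyContinuousSemigroup Λ)
    (σ : H →L[ℂ] H) (hσ : OpenQuantum.IsFaithfulInvariantState Λ σ)
    (hab : ∀ A ∈ OpenQuantum.decoherenceFree Λ, ∀ B ∈ OpenQuantum.decoherenceFree Λ,
      A * B = B * A)
    {I : Type*} [Fintype I] (P : I → (H →L[ℂ] H))
    (hP : OpenQuantum.IsMinimalResolution (OpenQuantum.decoherenceFree Λ) P) :
    (∀ k, ∃! ρ : H →L[ℂ] H, OpenQuantum.IsFaithfulInvariantStateOn Λ (P k) ρ) ∧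
    ∀ τ : I → (H →L[ℂ] H),
      (∀ k, OpenQuantum.IsFaithfulInvariantStateOn Λ (P k) (τ k)) →
      ∀ K γ : ℝ, 0 < K → 0 < γ →
      (∀ t : ℝ≥0, ‖Λ t - (OpenQuantum.condExpectation P τ).comp (Λ t)‖
        ≤ K * Real.exp (-γ * (t : ℝ))) →
      ∀ {Ω₁ Ω₂ : Type*} [Fintype Ω₁] [Fintype Ω₂]
        (E : Ω₁ → (H →L[ℂ] H)) (F : Ω₂ → (H →L[ℂ] H)),
      OpenQuantum.IsObservable E → OpenQuantum.IsObservable F →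
      OpenQuantum.IsRegular P E → OpenQuantum.IsRegular P F →
      ∀ t : ℝ≥0,
        -(1 / γ) * Real.log
            (OpenQuantum.lam P τ E * OpenQuantum.lam P τ F / (2 * K)) ≤ (t : ℝ) →
        OpenQuantum.JointlyMeasurable (fun i => Λ t (E i)) (fun j => Λ t (F j)) := by
  open OpenQuantum in
  have hproj : ∀ k, IsStarProjection (P k) := fun k => (hP.minimal k).projection
  have hfix : ∀ k t, Λ t (P k) = P k := fun k =>
    map_eq_self_of_mem_decoherenceFree hΛ hab (hproj k) (hP.minimal k).mem
  refine ⟨fun k => ?_, ?_⟩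
  · obtain ⟨ρ, hρ⟩ :=
      exists_isFaithfulInvariantStateOn hΛ hσ (hproj k) (hP.minimal k).ne_zero (hfix k)
    exact ⟨ρ, hρ, fun ρ' hρ' => hρ'.eq hΛ hσ (hP.minimal k) hρ⟩
  intro τ hτ K γ hK hγ hdecay Ω₁ Ω₂ _ _ E F hE hF hEreg hFreg t ht
  -- A zero Hilbert space carries no state of trace one.
  have hH : Nontrivial H := by
    by_contra h
    rw [not_nontrivial_iff_subsingleton] at h
    have h1 := hσ.state.2
    rw [Subsingleton.elim σ 0] at h1
    simp [tr] at h1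
  have := nonempty_of_sum_eq_one hE.sum_eq_one
  have := nonempty_of_sum_eq_one hF.sum_eq_one
  have := nonempty_of_sum_eq_one hP.sum_eq_one
  have hclose : ∀ A : H →L[ℂ] H, ‖A‖ ≤ 1 →
      ‖Λ t A - condExpectation P τ A‖ ≤ K * Real.exp (-γ * (t : ℝ)) := fun A hA => by
    have h := (Λ t - (condExpectation P τ).comp (Λ t)).le_opNorm A
    rw [sub_apply, ContinuousLinearMap.comp_apply,
      condExpectation_map hΛ hproj hfix hτ] at h
    refine h.trans ((mul_le_of_le_one_right (norm_nonneg _) hA).trans (hdecay t))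
  refine jointlyMeasurable_of_norm_sub_le (hE.map (hΛ.channel t)) (hF.map (hΛ.channel t))
    (hE.condExpectation hproj hP.sum_eq_one hτ) (hF.condExpectation hproj hP.sum_eq_one hτ)
    (smul_one_le_condExpectation_mul hproj hP.orthogonal hP.sum_eq_one hτ hE hF hEreg hFreg)
    (fun i => hclose _ (hE.norm_le_one i)) (fun j => hclose _ (hF.norm_le_one j)) ?_
  have hpos : 0 < lam P τ E * lam P τ F :=
    mul_pos (lam_pos hproj hτ hE hEreg) (lam_pos hproj hτ hF hFreg)
  -- The bound on `t` says exactly `2 K exp (-γ t) ≤ λ_E λ_F`; positivity of `λ_E λ_F` makes the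
  -- logarithm genuine.
  have h1 : -γ * (t : ℝ) ≤ Real.log (lam P τ E * lam P τ F / (2 * K)) := by
    have h2 := mul_le_mul_of_nonneg_left ht hγ.le
    have h3 : γ * (-(1 / γ) * Real.log (lam P τ E * lam P τ F / (2 * K))) =
        -Real.log (lam P τ E * lam P τ F / (2 * K)) := by field_simp
    linarith
  rw [Real.le_log_iff_exp_le (by positivity), le_div_iff₀ (by positivity)] at h1
  linarith
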